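/- Let $\delta>0$. There exist a nonzero positive Radon measure $\mu$ on $\mathbb{R}$ without atoms such that \[ \mu(I)\le (1+\delta)\,\mu(J)\qquad\text{for any two adjacent intervals } I,J \text{ of equal positive length}, \] and a function $g$ in the generalized Zygmund class $\Lambda_\mu$, such that $g$ has infinite $\Phi_q$-variation on $[a,b]$ for every $0<q<1$ and every $a<b$ (with $\mu$ and $g$ independent of $q$, $\Phi_q$, $a$, $b$). Here $\Lambda_\mu$ is the set of continuous functions $g\colon\mathbb{R}\to\mathbb{R}$ for which there is a constant $M>0$ with \[ |g(x+h)-2g(x)+g(x-h)|\le M\,\mu([x-h,x+h])\qquad\text{for all } x\in\mathbb{R},\ h\ge 0; \] $\Phi_q\colon[0,\infty)\to[0,\infty)$ is any convex increasing function with $\Phi_q(t)=t/(\log (1/t))^q$ for all sufficiently small $t>0$; and $g$ has infinite $\Phi$-variation on $[a,b]$ if \[ \sup \sum_{j=1}^N \Phi\big(|g(x_j)-g(x_{j-1})|\big)=\infty, \] where the supremum is over all $N\ge 1$ and all partitions $a=x_0<\dots<x_N=b$. -/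

import Mathlib

open MeasureTheory Set Filter Topology
open scoped ENNReal

/-- The measure `μ` on `ℝ` is nonzero and `μ I ≤ (1 + δ) μ J` for any two adjacent intervals
`I`, `J` of equal length; `I` may lie on either side of `J`. (For measures without atoms
it does not matter whether the endpoints belong to the intervals.) -/
def IsDoublingWith (μ : Measure ℝ) (δ : ℝ) : Prop :=
  μ ≠ 0 ∧ ∀ x h : ℝ, 0 < h →
    μ (Icc (x - h) x) ≤ ENNReal.ofReal (1 + δ) * μ (Icc x (x + h)) ∧
    μ (Icc x (x + h)) ≤ ENNReal.ofReal (1 + δ) * μ (Icc (x - h) x)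

/-- The generalized Zygmund class `Λ_μ`. -/
def ZygmundClass (μ : Measure ℝ) : Set (ℝ → ℝ) :=
  {g | Continuous g ∧ ∃ M : ℝ, 0 < M ∧ ∀ x h : ℝ, 0 ≤ h →
    ENNReal.ofReal |g (x + h) - 2 * g x + g (x - h)| ≤
      ENNReal.ofReal M * μ (Icc (x - h) (x + h))}

/-- `Φ`, restricted to `[0, ∞)`, is a convex increasing function into `[0, ∞)` with
`Φ t = t / (log (1 / t)) ^ q` for all sufficiently small `t > 0`. -/
structure IsLogGauge (q : ℝ) (Φ : ℝ → ℝ) : Prop where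
  nonneg : ∀ t, 0 ≤ t → 0 ≤ Φ t
  convex : ConvexOn ℝ (Ici 0) Φ
  mono : MonotoneOn Φ (Ici 0)
  eq_small : ∃ ε : ℝ, 0 < ε ∧ ∀ t, 0 < t → t < ε → Φ t = t / (Real.log (1 / t)) ^ q

/-- The sums `∑ Φ(|v (x_j) - v (x_{j-1})|)` over all partitions `a = x_0 < ⋯ < x_N = b`,
`N ≥ 1`. -/
def phiVariationSums (Φ : ℝ → ℝ) (v : ℝ → ℝ) (a b : ℝ) : Set ℝ :=
  {S | ∃ (N : ℕ) (x : ℕ → ℝ), 1 ≤ N ∧ x 0 = a ∧ x N = b ∧ (∀ j < N, x j < x (j + 1)) ∧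
    S = ∑ j ∈ Finset.range N, Φ |v (x (j + 1)) - v (x j)|}

/-- `v` has finite `Φ`-variation on `[a, b]`. -/
def HasFinitePhiVariation (Φ : ℝ → ℝ) (v : ℝ → ℝ) (a b : ℝ) : Prop :=
  BddAbove (phiVariationSums Φ v a b)

/-! Both objects live on the grid of cells `[j / 4 ^ n, (j + 1) / 4 ^ n]`. A cell of density `u`
passes the densities `u(1+ε), u(1-ε), u(1-ε), u(1+ε)` to its quarters. Since the outer factors
agree, the density ratio across a common endpoint of two cells persists under refinement, so
neighbouring densities always differ by a factor at most `(1+ε)/(1-ε)`. An interval is compared with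
boundedly many cells of its own scale, and a small `ε` gives the constant `1 + δ`
(`IsSelfSimilar.doubling`).

The Zygmund function adds to a slope `v` the increments `0, u, -u, 0`. The outer quarters inherit
`v`, so slope jumps between neighbours stay at most a multiple of `u`. Hence the function is linear,
up to the mass, at the scale of each interval (`IsSelfAffine.zygmund`).

For the variation, set `m = v / u`. The children have weights `(1±ε)/4` and ratios `m/(1+ε)`,
`(m±1)/(1-ε)`, whose weighted mean is `m`. For `A(m) = |m| - log(1+|m|)`, Jensen's inequality has a
gain bounded below uniformly in `m` (`absSubLog_step`): as `m` grows, the separation of the ratios,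
of order `ε|m|`, compensates the decay of `A''`. So the sum of `|v| / 4 ^ n` over a fixed cell grows
at least linearly in the level (`le_sum_abs_slope`). A logarithmic gauge costs only a factor of
order `n ^ q`, and `n ^ (1 - q)` diverges. -/

/-- The `4`-periodic sign pattern `(1, -1, -1, 1)`. -/
def outerSign (i : ℤ) : ℝ := if i % 4 = 0 ∨ i % 4 = 3 then 1 else -1

/-- The density of the `n`-th approximation of the measure on `[j / 4 ^ n, (j + 1) / 4 ^ n]`. -/
noncomputable def density (ε : ℝ) : ℕ → ℤ → ℝ
  | 0, _ => 1
  | n + 1, j => density ε n (j / 4) * (1 + ε * outerSign j)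

/-- The slope on `[j / 4 ^ n, (j + 1) / 4 ^ n]` of the piecewise linear interpolation of the
self-affine function with profile `P`. -/
noncomputable def slope4 (ε : ℝ) (P : ℤ → ℝ) : ℕ → ℤ → ℝ
  | 0, _ => 0
  | n + 1, j => slope4 ε P n (j / 4) + (P (j + 1) - P j) * density ε n (j / 4)

/-- Admissible values at the points `i / 4` for a `1`-periodic self-affine function. -/
structure IsProfile (P : ℤ → ℝ) : Prop where
  periodic : ∀ i, P (i + 4) = P i
  zero : P 0 = 0
  bound : ∀ i, |P i| ≤ 1
  diff_bound : ∀ i, |P (i + 1) - P i| ≤ 1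

/-- `W` is a bounded solution of the self-affinity equation with profile `P`. -/
structure IsSelfAffine (ε : ℝ) (P : ℤ → ℝ) (W : ℝ → ℝ) : Prop where
  bdd : ∃ C, ∀ x, |W x| ≤ C
  step : ∀ (i : ℤ) (z : ℝ), 0 ≤ z → z ≤ 1 →
    W ((i + z) / 4) = (P i + (P (i + 1) - P i) * z + (1 + ε * outerSign i) * W z) / 4

lemma outerSign_add_mul (i k : ℤ) : outerSign (i + 4 * k) = outerSign i := by
  unfold outerSign; rw [Int.add_mul_emod_self_left]

lemma abs_outerSign (i : ℤ) : |outerSign i| = 1 := by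
  unfold outerSign; split_ifs <;> simp

lemma outerSign_le (i : ℤ) : outerSign i ≤ 1 := (le_abs_self _).trans (abs_outerSign i).le

lemma neg_one_le_outerSign (i : ℤ) : -1 ≤ outerSign i :=
  (abs_le.1 (abs_outerSign i).le).1

lemma IsProfile.add_mul {P : ℤ → ℝ} (hP : IsProfile P) (i k : ℤ) : P (i + 4 * k) = P i := by
  have h : Function.Periodic P 4 := hP.periodic
  have := h.int_mul k i
  rwa [mul_comm] at this

/-! ### Solving the self-affinity equation by a series -/

/-- The piecewise linear function with value `P i / 4` at `i / 4`. -/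
noncomputable def profileInterp (P : ℤ → ℝ) (x : ℝ) : ℝ :=
  (P ⌊4 * x⌋ + (P (⌊4 * x⌋ + 1) - P ⌊4 * x⌋) * Int.fract (4 * x)) / 4

/-- The terms of the series that solves the self-affinity equation. -/
noncomputable def selfAffineTerm (ε : ℝ) (P : ℤ → ℝ) (n : ℕ) (x : ℝ) : ℝ :=
  (∏ k ∈ Finset.range n, (1 + ε * outerSign ⌊4 ^ (k + 1) * x⌋) / 4) * profileInterp P (4 ^ n * x)

lemma IsProfile.interp_add_int {P : ℤ → ℝ} (hP : IsProfile P) (x : ℝ) (k : ℤ) :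
    profileInterp P (x + k) = profileInterp P x := by
  have h : 4 * (x + k) = 4 * x + ((4 * k : ℤ) : ℝ) := by push_cast; ring
  unfold profileInterp
  rw [h, Int.floor_add_intCast, Int.fract_add_intCast, hP.add_mul, add_right_comm, hP.add_mul]

lemma IsProfile.abs_interp_le {P : ℤ → ℝ} (hP : IsProfile P) (x : ℝ) :
    |profileInterp P x| ≤ 1 := by
  have h1 := abs_le.1 (hP.bound ⌊4 * x⌋)
  have h2 := abs_le.1 (hP.diff_bound ⌊4 * x⌋)
  have h3 := Int.fract_nonneg (4 * x)
  have h4 := (Int.fract_lt_one (4 * x)).le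
  unfold profileInterp
  rw [abs_le]
  constructor <;> nlinarith

lemma selfAffineTerm_succ (ε : ℝ) (P : ℤ → ℝ) (n : ℕ) (x : ℝ) :
    selfAffineTerm ε P (n + 1) x =
      (1 + ε * outerSign ⌊4 * x⌋) / 4 * selfAffineTerm ε P n (4 * x) := by
  unfold selfAffineTerm
  rw [Finset.prod_range_succ']
  simp only [zero_add, pow_one, ← mul_assoc, ← pow_succ]
  ring

lemma IsProfile.term_add_int {P : ℤ → ℝ} (hP : IsProfile P) (ε : ℝ) (n : ℕ) (x : ℝ) (i : ℤ) :
    selfAffineTerm ε P n (x + i) = selfAffineTerm ε P n x := by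
  induction n generalizing x i with
  | zero => simp [selfAffineTerm, hP.interp_add_int]
  | succ n ih =>
    have h : 4 * (x + i) = 4 * x + ((4 * i : ℤ) : ℝ) := by push_cast; ring
    rw [selfAffineTerm_succ, selfAffineTerm_succ, h, ih, Int.floor_add_intCast, outerSign_add_mul]

lemma IsProfile.abs_term_le {P : ℤ → ℝ} (hP : IsProfile P) {ε : ℝ} (h0 : 0 ≤ ε) (h1 : ε ≤ 1)
    (n : ℕ) (x : ℝ) : |selfAffineTerm ε P n x| ≤ (1 / 2) ^ n := by
  induction n generalizing x with
  | zero => simpa [selfAffineTerm] using hP.abs_interp_le x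
  | succ n ih =>
    rw [selfAffineTerm_succ, abs_mul, pow_succ, mul_comm ((1 / 2 : ℝ) ^ n)]
    refine mul_le_mul ?_ (ih _) (abs_nonneg _) (by norm_num)
    have := outerSign_le ⌊4 * x⌋
    have := neg_one_le_outerSign ⌊4 * x⌋
    rw [abs_le]
    constructor <;> nlinarith

lemma IsProfile.exists_selfAffine {P : ℤ → ℝ} (hP : IsProfile P) {ε : ℝ} (h0 : 0 ≤ ε)
    (h1 : ε ≤ 1) : ∃ W, IsSelfAffine ε P W := by
  have hsum : ∀ x, Summable fun n => selfAffineTerm ε P n x := fun x =>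
    summable_geometric_two.of_norm_bounded (f := fun n => selfAffineTerm ε P n x)
      fun n => hP.abs_term_le h0 h1 n x
  set W : ℝ → ℝ := fun x => ∑' n, selfAffineTerm ε P n x with hW
  have hper : ∀ (x : ℝ) (i : ℤ), W (x + i) = W x := fun x i => by
    simp only [hW, hP.term_add_int]
  have heq : ∀ x, W x = profileInterp P x + (1 + ε * outerSign ⌊4 * x⌋) / 4 * W (4 * x) := by
    intro x
    simp only [hW]
    rw [(hsum x).tsum_eq_zero_add]
    simp only [selfAffineTerm_succ, tsum_mul_left]
    simp [selfAffineTerm]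
  have hzero : W 0 = 0 := by
    have := heq 0
    simp only [profileInterp, mul_zero, Int.floor_zero, hP.zero, Int.fract_zero] at this
    have h3 := outerSign_le 0
    have h4 : (1 + ε * outerSign 0) ≤ 2 := by nlinarith
    -- At the fixed point `0` of `x ↦ 4 * x` the equation is homogeneous with factor at most `1/2`.
    have h5 : W 0 * (1 - (1 + ε * outerSign 0) / 4) = 0 := by linarith
    rcases mul_eq_zero.1 h5 with h | h
    · exact h
    · linarith
  have hint : ∀ i : ℤ, W i = 0 := fun i => by
    have := hper 0 i
    rwa [zero_add, hzero] at this
  refine ⟨W, ⟨2, fun x => ?_⟩, fun i z hz0 hz1 => ?_⟩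
  · exact tsum_of_norm_bounded (f := fun n => selfAffineTerm ε P n x) hasSum_geometric_two
      fun n => hP.abs_term_le h0 h1 n x
  · rcases hz1.lt_or_eq with hz | rfl
    · have h4 : 4 * ((i + z) / 4) = z + i := by ring
      have hf : ⌊z + i⌋ = i := by
        rw [Int.floor_add_intCast, Int.floor_eq_zero_iff.2 ⟨hz0, hz⟩, zero_add]
      have hfr : Int.fract (z + i) = z := by
        rw [Int.fract_add_intCast, Int.fract_eq_self.2 ⟨hz0, hz⟩]
      rw [heq, profileInterp, h4, hf, hfr, hper]
      ring
    -- At `z = 1` the floor jumps to `i + 1`, so a different branch of the series is used; the two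
    -- agree because `W` vanishes at the integers.
    · have h4 : 4 * (((i : ℝ) + 1) / 4) = ((i + 1 : ℤ) : ℝ) := by push_cast; ring
      have h5 : W 1 = 0 := by simpa using hint 1
      rw [heq, profileInterp, h4, hint, Int.floor_intCast, Int.fract_intCast, h5]
      ring

/-! ### Densities, slopes and continuity on the grid -/

section SelfAffine

variable {ε : ℝ} {P : ℤ → ℝ} {W : ℝ → ℝ}

lemma density_pos (h0 : 0 ≤ ε) (h1 : ε < 1) (n : ℕ) (j : ℤ) : 0 < density ε n j := by
  induction n generalizing j with
  | zero => simp [density]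
  | succ n ih =>
    have := neg_one_le_outerSign j
    exact mul_pos (ih _) (by nlinarith)

lemma density_le (h0 : 0 ≤ ε) (h1 : ε < 1) (n : ℕ) (j : ℤ) : density ε n j ≤ 2 ^ n := by
  induction n generalizing j with
  | zero => simp [density]
  | succ n ih =>
    have := outerSign_le j
    have h2 : 1 + ε * outerSign j ≤ 2 := by nlinarith
    have h3 : (0 : ℝ) ≤ 2 ^ n := by positivity
    rw [density, pow_succ]
    have := ih (j / 4)
    have := density_pos h0 h1 n (j / 4)
    nlinarith

lemma IsProfile.abs_slope_le (hP : IsProfile P) (h0 : 0 ≤ ε) (h1 : ε < 1) (n : ℕ) (j : ℤ) :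
    |slope4 ε P n j| ≤ 2 ^ n := by
  induction n generalizing j with
  | zero => simp [slope4]
  | succ n ih =>
    rw [slope4, pow_succ, mul_two]
    refine (abs_add_le _ _).trans (add_le_add (ih _) ?_)
    rw [abs_mul, abs_of_pos (density_pos h0 h1 _ _)]
    have := density_le h0 h1 n (j / 4)
    have := density_pos h0 h1 n (j / 4)
    have := hP.diff_bound j
    nlinarith [abs_nonneg (P (j + 1) - P j)]

/-- Densities of neighbouring intervals are comparable. -/
lemma density_adjacent (h0 : 0 ≤ ε) (h1 : ε < 1) (n : ℕ) (j : ℤ) :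
    density ε n (j + 1) ≤ (1 + ε) / (1 - ε) * density ε n j ∧
      density ε n j ≤ (1 + ε) / (1 - ε) * density ε n (j + 1) := by
  have hρ : 1 ≤ (1 + ε) / (1 - ε) := by rw [le_div_iff₀ (by linarith)]; linarith
  induction n generalizing j with
  | zero => simpa [density] using hρ
  | succ n ih =>
    simp only [density]
    by_cases h : j % 4 = 3
    -- The cells have different, adjacent parents. Both are outer quarters, so the common factor `1
    -- + ε` leaves the parents' ratio unchanged.
    · have e : (j + 1) / 4 = j / 4 + 1 := by omega
      have s1 : outerSign j = 1 := by simp [outerSign, h]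
      have s2 : outerSign (j + 1) = 1 := by
        have : (j + 1) % 4 = 0 := by omega
        simp [outerSign, this]
      rw [e, s1, s2, ← mul_assoc, ← mul_assoc]
      exact ⟨mul_le_mul_of_nonneg_right (ih _).1 (by linarith),
        mul_le_mul_of_nonneg_right (ih _).2 (by linarith)⟩
    · have e : (j + 1) / 4 = j / 4 := by omega
      rw [e]
      have key : ∀ a b : ℤ, 1 + ε * outerSign a ≤ (1 + ε) / (1 - ε) * (1 + ε * outerSign b) := by
        intro a b
        have ha : 1 + ε * outerSign a ≤ 1 + ε := by nlinarith [outerSign_le a]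
        have hb : 1 - ε ≤ 1 + ε * outerSign b := by nlinarith [neg_one_le_outerSign b]
        calc _ ≤ 1 + ε := ha
          _ = (1 + ε) / (1 - ε) * (1 - ε) := by
            have : 1 - ε ≠ 0 := by linarith
            field_simp
          _ ≤ _ := mul_le_mul_of_nonneg_left hb (by linarith)
      have hp := (density_pos h0 h1 n (j / 4)).le
      constructor
      · rw [mul_left_comm]; exact mul_le_mul_of_nonneg_left (key _ _) hp
      · rw [mul_left_comm]; exact mul_le_mul_of_nonneg_left (key _ _) hp

lemma density_add_le (h0 : 0 ≤ ε) (h1 : ε < 1) (n : ℕ) (j : ℤ) (k : ℕ) :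
    density ε n (j + k) ≤ ((1 + ε) / (1 - ε)) ^ k * density ε n j ∧
      density ε n j ≤ ((1 + ε) / (1 - ε)) ^ k * density ε n (j + k) := by
  have hρ : 0 ≤ (1 + ε) / (1 - ε) := div_nonneg (by linarith) (by linarith)
  induction k with
  | zero => simp
  | succ k ih =>
    have h := density_adjacent h0 h1 n (j + k)
    have e : j + ((k + 1 : ℕ) : ℤ) = j + k + 1 := by push_cast; ring
    rw [e, pow_succ]
    constructor
    · refine h.1.trans ?_
      rw [mul_comm (_ ^ k), mul_assoc]
      exact mul_le_mul_of_nonneg_left ih.1 hρ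
    · refine ih.2.trans ?_
      rw [mul_assoc]
      exact mul_le_mul_of_nonneg_left h.2 (pow_nonneg hρ k)

/-- Slopes on neighbouring intervals differ by at most a multiple of the density, provided that the
slopes do not change on the outer subintervals. -/
lemma IsProfile.slope_adjacent (hP : IsProfile P) (hP1 : P 1 = 0) (hP3 : P 3 = 0)
    (h0 : 0 ≤ ε) (h1 : ε ≤ 1 / 2) (n : ℕ) (j : ℤ) :
    |slope4 ε P n (j + 1) - slope4 ε P n j| ≤ 4 * density ε n j := by
  induction n generalizing j with
  | zero => simp [slope4, density]
  | succ n ih =>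
    simp only [slope4, density]
    have hp := (density_pos h0 (by linarith) n (j / 4))
    by_cases h : j % 4 = 3
    · have e : (j + 1) / 4 = j / 4 + 1 := by omega
      have s1 : outerSign j = 1 := by simp [outerSign, h]
      have p0 : P j = 0 := by
        rw [show j = 3 + 4 * (j / 4) by omega, hP.add_mul, hP3]
      have p1 : P (j + 1) = 0 := by
        rw [show j + 1 = 0 + 4 * (j / 4 + 1) by omega, hP.add_mul, hP.zero]
      have p2 : P (j + 1 + 1) = 0 := by
        rw [show j + 1 + 1 = 1 + 4 * (j / 4 + 1) by omega, hP.add_mul, hP1]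
      rw [e, s1, p0, p1, p2]
      have := ih (j / 4)
      -- Both slopes are inherited, so the jump is that of the parents, while the density has grown
      -- by `1 + ε`.
      simp only [sub_zero, zero_mul, add_zero]
      nlinarith
    · have e : (j + 1) / 4 = j / 4 := by omega
      rw [e, add_sub_add_left_eq_sub, ← sub_mul, abs_mul, abs_of_pos hp]
      have h2 : |P (j + 1 + 1) - P (j + 1) - (P (j + 1) - P j)| ≤ 2 := by
        have := abs_sub (P (j + 1 + 1) - P (j + 1)) (P (j + 1) - P j)
        have := hP.diff_bound j
        have := hP.diff_bound (j + 1)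
        linarith
      -- The jump is at most twice the parent density, and a child keeps at least half of that
      -- density; hence the constant `4`.
      have h3 : 1 / 2 ≤ 1 + ε * outerSign j := by nlinarith [neg_one_le_outerSign j]
      nlinarith

lemma IsSelfAffine.at_quarter (hW : IsSelfAffine ε P W) (hP : IsProfile P) (h0 : 0 ≤ ε)
    (h1 : ε < 1) (i : ℤ) : W (i / 4) = P i / 4 := by
  have hz : W 0 = 0 := by
    have := hW.step 0 0 le_rfl zero_le_one
    simp only [hP.zero, Int.cast_zero, add_zero, zero_div, mul_zero, zero_add] at this
    have h4 : (1 + ε * outerSign 0) ≤ 2 := by nlinarith [outerSign_le 0]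
    have h5 : W 0 * (1 - (1 + ε * outerSign 0) / 4) = 0 := by linarith
    rcases mul_eq_zero.1 h5 with h | h
    · exact h
    · linarith
  have := hW.step i 0 le_rfl zero_le_one
  rw [hz] at this
  simpa using this

lemma IsSelfAffine.at_int (hW : IsSelfAffine ε P W) (hP : IsProfile P) (h0 : 0 ≤ ε)
    (h1 : ε < 1) (i : ℤ) : W i = 0 := by
  have h := hW.at_quarter hP h0 h1 (4 * i)
  have h2 := hP.add_mul 0 i
  rw [zero_add, hP.zero] at h2
  rw [h2] at h
  push_cast at h
  rw [mul_div_cancel_left₀ _ (by norm_num : (4 : ℝ) ≠ 0)] at h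
  simpa using h

/-- The right-hand side of the equation depends on `i` only modulo `4`, and shifting `i` by `4 * k`
shifts the argument by `k`. -/
lemma IsSelfAffine.add_int (hW : IsSelfAffine ε P W) (hP : IsProfile P) (x : ℝ) (k : ℤ) :
    W (k + x) = W x := by
  have hf := Int.fract_nonneg (4 * x)
  have hf1 := (Int.fract_lt_one (4 * x)).le
  have hx : (4 * x) = ⌊4 * x⌋ + Int.fract (4 * x) := (Int.floor_add_fract _).symm
  have e1 := hW.step ⌊4 * x⌋ _ hf hf1
  have e2 := hW.step (⌊4 * x⌋ + 4 * k) _ hf hf1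
  rw [hP.add_mul, add_right_comm ⌊4 * x⌋, hP.add_mul, outerSign_add_mul, ← e1] at e2
  convert e2 using 2
  · push_cast; linarith
  · linarith

/-- The self-affinity of `W` on the intervals `[j / 4 ^ n, (j + 1) / 4 ^ n]`. -/
lemma IsSelfAffine.grid (hW : IsSelfAffine ε P W) (hP : IsProfile P) (h0 : 0 ≤ ε)
    (h1 : ε < 1) (n : ℕ) (j : ℤ) (y : ℝ) (hy0 : 0 ≤ y) (hy1 : y ≤ 1) :
    W ((j + y) / 4 ^ n) =
      W (j / 4 ^ n) + (slope4 ε P n j * y + density ε n j * W y) / 4 ^ n := by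
  induction n generalizing j y with
  | zero =>
    simp [slope4, density, hW.add_int hP, hW.at_int hP h0 h1]
  | succ n ih =>
    have hj : (j : ℝ) = 4 * (j / 4 : ℤ) + (j % 4 : ℤ) := by
      exact_mod_cast (Int.mul_ediv_add_emod j 4).symm
    have hm0 : (0 : ℝ) ≤ (j % 4 : ℤ) := by exact_mod_cast Int.emod_nonneg j (by norm_num)
    have hm1 : ((j % 4 : ℤ) : ℝ) ≤ 3 := by
      have : j % 4 ≤ 3 := by omega
      exact_mod_cast this
    have hPj : P (j % 4) = P j := by
      rw [show P j = P (j % 4 + 4 * (j / 4)) by rw [Int.emod_add_mul_ediv], hP.add_mul]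
    have hPj1 : P (j % 4 + 1) = P (j + 1) := by
      rw [show j + 1 = j % 4 + 1 + 4 * (j / 4) by omega, hP.add_mul]
    have hS : outerSign (j % 4) = outerSign j := by simp [outerSign]
    have key : ∀ z : ℝ, 0 ≤ z → z ≤ 1 → W ((j + z) / 4 ^ (n + 1)) =
        W ((j / 4 : ℤ) / 4 ^ n) + (slope4 ε P n (j / 4) * (((j % 4 : ℤ) + z) / 4) +
          density ε n (j / 4) *
            ((P j + (P (j + 1) - P j) * z + (1 + ε * outerSign j) * W z) / 4)) / 4 ^ n := by
      intro z hz0 hz1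
      have h2 := ih (j / 4) (((j % 4 : ℤ) + z) / 4) (by positivity) (by linarith)
      rw [hW.step _ z hz0 hz1, hPj, hPj1, hS] at h2
      rw [← h2]
      congr 1
      rw [hj, pow_succ]
      field_simp
      ring
    have k0 := key 0 le_rfl zero_le_one
    have hz : W 0 = 0 := by simpa using hW.at_int hP h0 h1 0
    rw [add_zero, hz] at k0
    rw [key y hy0 hy1, k0, slope4, density, pow_succ]
    field_simp
    ring

/-- Slopes and densities grow at most like `2 ^ n` while cells shrink like `4 ^ (-n)`; this yields a
modulus of continuity. -/
lemma IsSelfAffine.exists_near_grid (hW : IsSelfAffine ε P W) (hP : IsProfile P) (h0 : 0 ≤ ε)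
    (h1 : ε < 1) : ∃ C, 0 ≤ C ∧ ∀ (n : ℕ) (j : ℤ) (y : ℝ), 0 ≤ y → y ≤ 1 →
      |W ((j + y) / 4 ^ n) - W (j / 4 ^ n)| ≤ C * (1 / 2) ^ n := by
  obtain ⟨C, hC⟩ := hW.bdd
  have hC0 : 0 ≤ C := (abs_nonneg _).trans (hC 0)
  refine ⟨1 + C, by positivity, fun n j y hy0 hy1 => ?_⟩
  rw [hW.grid hP h0 h1 n j y hy0 hy1, add_sub_cancel_left, abs_div,
    abs_of_pos (by positivity : (0 : ℝ) < 4 ^ n), div_le_iff₀ (by positivity)]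
  have e : (1 + C) * (1 / 2) ^ n * 4 ^ n = (1 + C) * (2 : ℝ) ^ n := by
    rw [mul_assoc, ← mul_pow]; norm_num
  rw [e, add_mul, one_mul]
  refine (abs_add_le _ _).trans (add_le_add ?_ ?_)
  · rw [abs_mul, abs_of_nonneg hy0]
    exact (mul_le_of_le_one_right (abs_nonneg _) hy1).trans (hP.abs_slope_le h0 h1 n j)
  · rw [abs_mul, abs_of_pos (density_pos h0 h1 n j), mul_comm]
    exact mul_le_mul (hC y) (density_le h0 h1 n j) (density_pos h0 h1 n j).le hC0

/-- The representation `x = (j + y) / 4 ^ n` with `j = ⌊4 ^ n * x⌋`. -/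
lemma eq_floor_add_fract_div (n : ℕ) (x : ℝ) :
    x = ((⌊4 ^ n * x⌋ : ℝ) + Int.fract (4 ^ n * x)) / 4 ^ n := by
  rw [Int.floor_add_fract]
  field_simp

lemma IsSelfAffine.continuous (hW : IsSelfAffine ε P W) (hP : IsProfile P) (h0 : 0 ≤ ε)
    (h1 : ε < 1) : Continuous W := by
  obtain ⟨C, hC0, hC⟩ := hW.exists_near_grid hP h0 h1
  have near : ∀ n x, |W x - W (⌊4 ^ n * x⌋ / 4 ^ n)| ≤ C * (1 / 2) ^ n := fun n x => by
    have := hC n ⌊4 ^ n * x⌋ _ (Int.fract_nonneg (4 ^ n * x)) (Int.fract_lt_one _).le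
    rwa [← eq_floor_add_fract_div] at this
  have main : ∀ n (x y : ℝ), x ≤ y → y - x ≤ (1 / 4) ^ n → |W y - W x| ≤ 3 * C * (1 / 2) ^ n := by
    intro n x y hxy hd
    have hd' : 4 ^ n * y ≤ 4 ^ n * x + 1 := by
      have h4 : (4 : ℝ) ^ n * (1 / 4) ^ n = 1 := by rw [← mul_pow]; norm_num
      have := mul_le_mul_of_nonneg_left hd (by positivity : (0 : ℝ) ≤ 4 ^ n)
      linarith
    have hle : ⌊4 ^ n * x⌋ ≤ ⌊4 ^ n * y⌋ := Int.floor_le_floor (by gcongr)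
    have hle' : ⌊4 ^ n * y⌋ ≤ ⌊4 ^ n * x⌋ + 1 := by
      rw [← Int.floor_add_one]; exact Int.floor_le_floor hd'
    have hg : |W (⌊4 ^ n * y⌋ / 4 ^ n) - W (⌊4 ^ n * x⌋ / 4 ^ n)| ≤ C * (1 / 2) ^ n := by
      rcases (by omega : ⌊4 ^ n * y⌋ = ⌊4 ^ n * x⌋ ∨ ⌊4 ^ n * y⌋ = ⌊4 ^ n * x⌋ + 1) with h | h
      · rw [h, sub_self, abs_zero]; positivity
      · rw [h]; push_cast; exact hC n _ 1 zero_le_one le_rfl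
    have a1 := abs_le.1 (near n x)
    have a2 := abs_le.1 (near n y)
    have a3 := abs_le.1 hg
    rw [abs_le]
    constructor <;> linarith
  rw [Metric.continuous_iff]
  intro x e he
  have ht : Tendsto (fun n : ℕ => 3 * C * (1 / 2 : ℝ) ^ n) atTop (𝓝 0) := by
    simpa using (tendsto_pow_atTop_nhds_zero_of_lt_one (by norm_num : (0 : ℝ) ≤ 1 / 2)
      (by norm_num)).const_mul (3 * C)
  obtain ⟨n, hn⟩ := (ht.eventually_lt_const he).exists
  refine ⟨(1 / 4) ^ n, by positivity, fun y hy => ?_⟩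
  rw [Real.dist_eq] at hy ⊢
  have hy' := abs_le.1 hy.le
  refine lt_of_le_of_lt ?_ hn
  rcases le_total x y with h | h
  · exact main n x y h (by linarith)
  · rw [abs_sub_comm]; exact main n y x h (by linarith)

end SelfAffine

/-! ### The distribution function of the measure -/

/-- The profile of the periodic part of the distribution function of the measure. -/
def measureProfile (i : ℤ) : ℝ := if i % 4 = 1 then 1 else if i % 4 = 3 then -1 else 0

/-- The profile of the Zygmund function. -/
def tentProfile (i : ℤ) : ℝ := if i % 4 = 2 then 1 else 0

lemma measureProfile_diff (i : ℤ) : measureProfile (i + 1) - measureProfile i = outerSign i := by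
  unfold measureProfile outerSign
  rcases (by omega : i % 4 = 0 ∨ i % 4 = 1 ∨ i % 4 = 2 ∨ i % 4 = 3) with h | h | h | h
  · simp [h, show (i + 1) % 4 = 1 by omega]
  · simp [h, show (i + 1) % 4 = 2 by omega]
  · simp [h, show (i + 1) % 4 = 3 by omega]
  · simp [h, show (i + 1) % 4 = 0 by omega]

lemma isProfile_measureProfile : IsProfile measureProfile where
  periodic i := by simp [measureProfile]
  zero := by simp [measureProfile]
  bound i := by unfold measureProfile; split_ifs <;> simp
  diff_bound i := by rw [measureProfile_diff, abs_outerSign]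

lemma isProfile_tentProfile : IsProfile tentProfile where
  periodic i := by simp [tentProfile]
  zero := by simp [tentProfile]
  bound i := by unfold tentProfile; split_ifs <;> simp
  diff_bound i := by unfold tentProfile; split_ifs <;> simp

/-- The profile increments are exactly the signs, so `x + ε * W x` has the densities as its slopes
on the grid. -/
lemma one_add_slope4_measureProfile (ε : ℝ) (n : ℕ) (j : ℤ) :
    1 + ε * slope4 ε measureProfile n j = density ε n j := by
  induction n generalizing j with
  | zero => simp [slope4, density]
  | succ n ih =>
    rw [slope4, density, measureProfile_diff, ← ih]
    ring

/-- `F` is a self-similar distribution function with densities `density ε`. -/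
structure IsSelfSimilar (ε : ℝ) (F : ℝ → ℝ) : Prop where
  cont : Continuous F
  one : F 1 = 1
  grid : ∀ (n : ℕ) (j : ℤ) (y : ℝ), 0 ≤ y → y ≤ 1 →
    F ((j + y) / 4 ^ n) = F (j / 4 ^ n) + density ε n j * F y / 4 ^ n

lemma exists_isSelfSimilar {ε : ℝ} (h0 : 0 ≤ ε) (h1 : ε < 1) : ∃ F, IsSelfSimilar ε F := by
  have hP := isProfile_measureProfile
  obtain ⟨W, hW⟩ := hP.exists_selfAffine h0 h1.le
  refine ⟨fun x => x + ε * W x, continuous_id.add ((hW.continuous hP h0 h1).const_mul ε), ?_, ?_⟩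
  · have := hW.at_int hP h0 h1 1
    push_cast at this
    simp [this]
  · intro n j y hy0 hy1
    rw [hW.grid hP h0 h1 n j y hy0 hy1, ← one_add_slope4_measureProfile]
    field_simp
    ring

namespace IsSelfSimilar

variable {ε : ℝ} {F : ℝ → ℝ}

lemma grid_succ (hF : IsSelfSimilar ε F) (n : ℕ) (j : ℤ) :
    4 ^ n * (F ((j + 1) / 4 ^ n) - F (j / 4 ^ n)) = density ε n j := by
  rw [hF.grid n j 1 zero_le_one le_rfl, hF.one]
  field_simp
  ring

lemma mul_le_grid_sub (hF : IsSelfSimilar ε F) (n : ℕ) (j : ℤ) (k : ℕ) (U : ℝ)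
    (hU : ∀ i, j ≤ i → i < j + k → U ≤ density ε n i) :
    U * k ≤ 4 ^ n * (F ((j + k) / 4 ^ n) - F (j / 4 ^ n)) := by
  induction k with
  | zero => simp
  | succ k ih =>
    have h1 := ih fun i hi hi' => hU i hi (by push_cast; linarith)
    have h2 := hF.grid_succ n (j + k)
    have h3 := hU (j + k) (by omega) (by push_cast; omega)
    push_cast at h2 ⊢
    rw [← add_assoc]
    linarith

lemma grid_sub_le_mul (hF : IsSelfSimilar ε F) (n : ℕ) (j : ℤ) (k : ℕ) (U : ℝ)
    (hU : ∀ i, j ≤ i → i < j + k → density ε n i ≤ U) :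
    4 ^ n * (F ((j + k) / 4 ^ n) - F (j / 4 ^ n)) ≤ U * k := by
  induction k with
  | zero => simp
  | succ k ih =>
    have h1 := ih fun i hi hi' => hU i hi (by push_cast; linarith)
    have h2 := hF.grid_succ n (j + k)
    have h3 := hU (j + k) (by omega) (by push_cast; omega)
    push_cast at h2 ⊢
    rw [← add_assoc]
    linarith

lemma grid_mono (hF : IsSelfSimilar ε F) (h0 : 0 ≤ ε) (h1 : ε < 1) (n : ℕ) {i j : ℤ}
    (hij : i ≤ j) : F (i / 4 ^ n) ≤ F (j / 4 ^ n) := by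
  obtain ⟨k, rfl⟩ := Int.le.dest hij
  have := hF.mul_le_grid_sub n i k 0 fun i _ _ => (density_pos h0 h1 n i).le
  rw [zero_mul] at this
  have := nonneg_of_mul_nonneg_right this (by positivity)
  push_cast
  linarith

lemma mono (hF : IsSelfSimilar ε F) (h0 : 0 ≤ ε) (h1 : ε < 1) : Monotone F := by
  have hlim : ∀ x, Tendsto (fun n : ℕ => F (⌊4 ^ n * x⌋ / 4 ^ n)) atTop (𝓝 (F x)) := by
    intro x
    refine (hF.cont.tendsto x).comp ?_
    have ht : Tendsto (fun n : ℕ => x - (1 / 4 : ℝ) ^ n) atTop (𝓝 x) := by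
      simpa using (tendsto_pow_atTop_nhds_zero_of_lt_one (by norm_num : (0 : ℝ) ≤ 1 / 4)
        (by norm_num)).const_sub x
    refine tendsto_of_tendsto_of_tendsto_of_le_of_le ht tendsto_const_nhds (fun n => ?_)
      fun n => ?_
    · have h4 : (1 / 4 : ℝ) ^ n * 4 ^ n = 1 := by rw [← mul_pow]; norm_num
      rw [le_div_iff₀ (by positivity), sub_mul, h4, mul_comm x]
      linarith [Int.lt_floor_add_one (4 ^ n * x)]
    · rw [div_le_iff₀ (by positivity), mul_comm x]
      exact Int.floor_le _
  intro x y hxy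
  refine le_of_tendsto_of_tendsto' (hlim x) (hlim y) fun n => hF.grid_mono h0 h1 n ?_
  exact Int.floor_le_floor (by gcongr)

/-- Only cells wholly inside `[x, y]` are counted; the partial cells at the two ends account for the
`2`. -/
lemma le_sub (hF : IsSelfSimilar ε F) (h0 : 0 ≤ ε) (h1 : ε < 1) (n : ℕ) {x y : ℝ} (hxy : x ≤ y)
    {U : ℝ} (hU0 : 0 ≤ U)
    (hU : ∀ i, ⌊4 ^ n * x⌋ ≤ i → i ≤ ⌊4 ^ n * y⌋ → U ≤ density ε n i) :
    U * (4 ^ n * (y - x) - 2) ≤ 4 ^ n * (F y - F x) := by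
  have hm := hF.mono h0 h1
  have hq : (0 : ℝ) < 4 ^ n := by positivity
  by_cases h : ⌊4 ^ n * x⌋ + 1 ≤ ⌊4 ^ n * y⌋
  · obtain ⟨k, hk⟩ := Int.le.dest h
    have h2 := hF.mul_le_grid_sub n (⌊4 ^ n * x⌋ + 1) k U fun i hi hi' =>
      hU i (by omega) (by omega)
    have hk' : ((⌊4 ^ n * x⌋ : ℝ) + 1) + k = ⌊4 ^ n * y⌋ := by exact_mod_cast hk
    push_cast at h2
    rw [hk'] at h2
    have h3 : F (⌊4 ^ n * y⌋ / 4 ^ n) ≤ F y := hm (by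
      rw [div_le_iff₀ hq, mul_comm]; exact Int.floor_le _)
    have h4 : F x ≤ F ((⌊4 ^ n * x⌋ + 1) / 4 ^ n) := hm (by
      rw [le_div_iff₀ hq, mul_comm]; exact (Int.lt_floor_add_one _).le)
    have h5 : 4 ^ n * (y - x) - 2 ≤ k := by
      have := Int.floor_le (4 ^ n * x)
      have := Int.lt_floor_add_one (4 ^ n * y)
      linarith
    calc _ ≤ U * k := mul_le_mul_of_nonneg_left h5 hU0
      _ ≤ _ := h2
      _ ≤ _ := by gcongr
  · have h2 : 4 ^ n * (y - x) - 2 ≤ 0 := by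
      have h3 : ⌊4 ^ n * y⌋ ≤ ⌊4 ^ n * x⌋ := by omega
      have h3' : (⌊4 ^ n * y⌋ : ℝ) ≤ ⌊4 ^ n * x⌋ := by exact_mod_cast h3
      have := Int.floor_le (4 ^ n * x)
      have := Int.lt_floor_add_one (4 ^ n * y)
      linarith
    have h3 := hm hxy
    calc _ ≤ 0 := mul_nonpos_of_nonneg_of_nonpos hU0 h2
      _ ≤ _ := mul_nonneg hq.le (by linarith)

lemma sub_le (hF : IsSelfSimilar ε F) (h0 : 0 ≤ ε) (h1 : ε < 1) (n : ℕ) {x y : ℝ} (hxy : x ≤ y)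
    {U : ℝ} (hU0 : 0 ≤ U)
    (hU : ∀ i, ⌊4 ^ n * x⌋ ≤ i → i ≤ ⌊4 ^ n * y⌋ → density ε n i ≤ U) :
    4 ^ n * (F y - F x) ≤ U * (4 ^ n * (y - x) + 2) := by
  have hm := hF.mono h0 h1
  have hq : (0 : ℝ) < 4 ^ n := by positivity
  have h : ⌊4 ^ n * x⌋ ≤ ⌊4 ^ n * y⌋ + 1 :=
    (Int.floor_le_floor (by gcongr : 4 ^ n * x ≤ 4 ^ n * y)).trans (by omega)
  obtain ⟨k, hk⟩ := Int.le.dest h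
  have h2 := hF.grid_sub_le_mul n ⌊4 ^ n * x⌋ k U fun i hi hi' => hU i (by omega) (by omega)
  have hk' : (⌊4 ^ n * x⌋ : ℝ) + k = ⌊4 ^ n * y⌋ + 1 := by exact_mod_cast hk
  rw [hk'] at h2
  have h3 : F (⌊4 ^ n * x⌋ / 4 ^ n) ≤ F x := hm (by
    rw [div_le_iff₀ hq, mul_comm]; exact Int.floor_le _)
  have h4 : F y ≤ F ((⌊4 ^ n * y⌋ + 1) / 4 ^ n) := hm (by
    rw [le_div_iff₀ hq, mul_comm]; exact (Int.lt_floor_add_one _).le)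
  have h5 : k ≤ 4 ^ n * (y - x) + 2 := by
    have := Int.floor_le (4 ^ n * y)
    have := Int.lt_floor_add_one (4 ^ n * x)
    linarith
  calc 4 ^ n * (F y - F x) ≤ 4 ^ n * (F ((⌊4 ^ n * y⌋ + 1) / 4 ^ n) -
        F (⌊4 ^ n * x⌋ / 4 ^ n)) := by gcongr
    _ ≤ U * k := h2
    _ ≤ _ := mul_le_mul_of_nonneg_left h5 hU0

end IsSelfSimilar

/-! ### The doubling property -/

/-- The least admissible level is taken. The exceptional level `0` covers arbitrarily long intervals
and is harmless, since the density there is constant. -/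
lemma exists_scale (N : ℕ) (h : ℝ) (hh : 0 < h) :
    ∃ n : ℕ, N ≤ 4 ^ n * h ∧ (n = 0 ∨ 4 ^ n * h < 4 * N) := by
  classical
  have hex : ∃ n : ℕ, (N : ℝ) ≤ 4 ^ n * h := by
    obtain ⟨n, hn⟩ := pow_unbounded_of_one_lt (N / h : ℝ) (by norm_num : (1 : ℝ) < 4)
    exact ⟨n, by rw [div_lt_iff₀ hh] at hn; exact hn.le⟩
  refine ⟨Nat.find hex, Nat.find_spec hex, ?_⟩
  rcases Nat.eq_zero_or_pos (Nat.find hex) with h0 | h0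
  · exact Or.inl h0
  · right
    have := Nat.find_min hex (Nat.sub_lt h0 one_pos)
    push Not at this
    have e : (4 : ℝ) ^ (Nat.find hex) = 4 * 4 ^ (Nat.find hex - 1) := by
      rw [← pow_succ', Nat.sub_add_cancel h0]
    rw [e]
    linarith

lemma floor_sub_floor_le (N : ℕ) {a b : ℝ} (h : b - a < N) : ⌊b⌋ ≤ ⌊a⌋ + N := by
  have h1 := Int.floor_le b
  have h2 := Int.lt_floor_add_one a
  have : (⌊b⌋ : ℝ) < ⌊a⌋ + N + 1 := by linarith
  have : ⌊b⌋ < ⌊a⌋ + N + 1 := by exact_mod_cast this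
  omega

/-- At the scale of an interval, the densities on that interval are comparable. -/
lemma exists_density_bounds {ε : ℝ} (h0 : 0 ≤ ε) (h1 : ε < 1) (N n : ℕ) {x h : ℝ}
    (hn : n = 0 ∨ 4 ^ n * h < 4 * N) :
    ∃ U, 0 < U ∧ ∀ i, ⌊4 ^ n * (x - h)⌋ ≤ i → i ≤ ⌊4 ^ n * (x + h)⌋ →
      U ≤ density ε n i ∧ density ε n i ≤ ((1 + ε) / (1 - ε)) ^ (16 * N) * U := by
  have hρ : 1 ≤ (1 + ε) / (1 - ε) := by rw [le_div_iff₀ (by linarith)]; linarith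
  rcases hn with rfl | hn
  · refine ⟨1, one_pos, fun i _ _ => ⟨le_rfl, ?_⟩⟩
    rw [mul_one]
    exact one_le_pow₀ hρ
  · set ρ := (1 + ε) / (1 - ε)
    set j := ⌊4 ^ n * (x - h)⌋
    have hp := density_pos h0 h1 n j
    have hρp : 0 < ρ ^ (8 * N) := by positivity
    -- At most `8 * N` steps separate any cell from the leftmost one, so densities vary by `ρ ^ (8 *
    -- N)` either way, giving the total spread `ρ ^ (16 * N)`.
    refine ⟨density ε n j / ρ ^ (8 * N), by positivity, fun i hi hi' => ?_⟩
    have hfl : ⌊4 ^ n * (x + h)⌋ ≤ j + (8 * N : ℕ) := floor_sub_floor_le _ (by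
      push_cast; linarith)
    obtain ⟨k, rfl⟩ := Int.le.dest hi
    have hk : k ≤ 8 * N := by omega
    obtain ⟨ha, hb⟩ := density_add_le h0 h1 n j k
    have hpk : ρ ^ k ≤ ρ ^ (8 * N) := pow_le_pow_right₀ hρ hk
    constructor
    · rw [div_le_iff₀ hρp, mul_comm]
      exact hb.trans (mul_le_mul_of_nonneg_right hpk (density_pos h0 h1 _ _).le)
    · refine (ha.trans (mul_le_mul_of_nonneg_right hpk hp.le)).trans (le_of_eq ?_)
      rw [show 16 * N = 8 * N + 8 * N by ring, pow_add]
      field_simp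

/-- Two errors share the margin `δ`: the variation of the density, absorbed by `1 + δ / 2`, and the
end cells, negligible once the interval contains many cells. -/
lemma IsSelfSimilar.doubling {ε δ : ℝ} {F : ℝ → ℝ} (hF : IsSelfSimilar ε F) (h0 : 0 ≤ ε)
    (h1 : ε < 1) (N : ℕ) (hδ : 0 < δ)
    (hNδ : (1 + δ / 2) * (N + 2) ≤ (1 + δ) * (N - 2))
    (hε : ((1 + ε) / (1 - ε)) ^ (16 * N) ≤ 1 + δ / 2) (x h : ℝ) (hh : 0 < h) :
    F x - F (x - h) ≤ (1 + δ) * (F (x + h) - F x) ∧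
      F (x + h) - F x ≤ (1 + δ) * (F x - F (x - h)) := by
  obtain ⟨n, hn, hn'⟩ := exists_scale N h hh
  obtain ⟨U, hU, hb⟩ := exists_density_bounds h0 h1 N n (x := x) hn'
  have hq : (0 : ℝ) < 4 ^ n := by positivity
  have f1 : ⌊4 ^ n * (x - h)⌋ ≤ ⌊4 ^ n * x⌋ :=
    Int.floor_le_floor (mul_le_mul_of_nonneg_left (by linarith) hq.le)
  have f2 : ⌊4 ^ n * x⌋ ≤ ⌊4 ^ n * (x + h)⌋ :=
    Int.floor_le_floor (mul_le_mul_of_nonneg_left (by linarith) hq.le)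
  set κ := ((1 + ε) / (1 - ε)) ^ (16 * N)
  have hκU : 0 ≤ κ * U := (density_pos h0 h1 n _).le.trans (hb _ le_rfl (f1.trans f2)).2
  have l1 := hF.le_sub h0 h1 n (by linarith : x - h ≤ x) hU.le
    fun i hi hi' => (hb i hi (hi'.trans f2)).1
  have l2 := hF.le_sub h0 h1 n (by linarith : x ≤ x + h) hU.le
    fun i hi hi' => (hb i (f1.trans hi) hi').1
  have u1 := hF.sub_le h0 h1 n (by linarith : x - h ≤ x) hκU
    fun i hi hi' => (hb i hi (hi'.trans f2)).2
  have u2 := hF.sub_le h0 h1 n (by linarith : x ≤ x + h) hκU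
    fun i hi hi' => (hb i (f1.trans hi) hi').2
  rw [sub_sub_cancel] at l1 u1
  rw [add_sub_cancel_left] at l2 u2
  set H := 4 ^ n * h
  have hmain : κ * U * (H + 2) ≤ (1 + δ) * (U * (H - 2)) := by
    have hH : (0 : ℝ) ≤ H + 2 := by positivity
    have : κ * (H + 2) ≤ (1 + δ) * (H - 2) := by
      have := mul_le_mul_of_nonneg_right hε hH
      nlinarith
    nlinarith
  constructor
  · refine le_of_mul_le_mul_left ?_ hq
    have := mul_le_mul_of_nonneg_left l2 (by linarith : 0 ≤ 1 + δ)
    linarith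
  · refine le_of_mul_le_mul_left ?_ hq
    have := mul_le_mul_of_nonneg_left l1 (by linarith : 0 ≤ 1 + δ)
    linarith

lemma exists_doubling_parameters {δ : ℝ} (hδ : 0 < δ) :
    ∃ (N : ℕ) (ε : ℝ), (1 + δ / 2) * (N + 2) ≤ (1 + δ) * (N - 2) ∧ 0 < ε ∧ ε ≤ 1 / 2 ∧
      ((1 + ε) / (1 - ε)) ^ (16 * N) ≤ 1 + δ / 2 := by
  -- This is the inequality for `N` solved for `N`. The choice of `N` precedes that of `ε`, which
  -- must be small relative to the exponent `16 * N`.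
  obtain ⟨N, hN⟩ := exists_nat_ge (2 * (4 + 3 * δ) / δ)
  rw [div_le_iff₀ hδ] at hN
  have hc : ContinuousAt (fun ε : ℝ => ((1 + ε) / (1 - ε)) ^ (16 * N)) 0 := by
    refine ContinuousAt.pow (ContinuousAt.div (by fun_prop) (by fun_prop) (by norm_num)) _
  have hev : ∀ᶠ ε in 𝓝 (0 : ℝ), ((1 + ε) / (1 - ε)) ^ (16 * N) < 1 + δ / 2 := by
    refine hc.eventually_lt_const ?_
    simp
    positivity
  have hev2 : ∀ᶠ ε in 𝓝[>] (0 : ℝ), ε ≤ 1 / 2 :=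
    nhdsWithin_le_nhds (Iic_mem_nhds (by norm_num))
  obtain ⟨ε, ⟨ha, hb⟩, hc⟩ :=
    ((hev.filter_mono nhdsWithin_le_nhds).and hev2 |>.and self_mem_nhdsWithin).exists
  refine ⟨N, ε, by linarith, hc, hb, ha.le⟩

/-! ### The Zygmund condition -/

/-- On a run of neighbouring intervals with comparable densities, the slopes are comparable. -/
lemma slope4_add_sub_le {ε : ℝ} (h0 : 0 ≤ ε) (h1 : ε ≤ 1 / 2) (n : ℕ) (j : ℤ) (k : ℕ) {D : ℝ}
    (hD : ∀ i, j ≤ i → i < j + k → density ε n i ≤ D) :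
    |slope4 ε tentProfile n (j + k) - slope4 ε tentProfile n j| ≤ 4 * k * D := by
  induction k with
  | zero => simp
  | succ k ih =>
    have a1 := abs_le.1 (ih fun i hi hi' => hD i hi (by push_cast; omega))
    have a2 := abs_le.1 (isProfile_tentProfile.slope_adjacent (by simp [tentProfile])
      (by simp [tentProfile]) h0 h1 n (j + k))
    have a3 := hD (j + k) (by omega) (by push_cast; omega)
    push_cast
    rw [← add_assoc, abs_le]
    constructor <;> linarith

/-- Along the run, every slope is within `4 * K * D` of the first one, and the part of `W` inside
the last cell contributes at most `C * D`. -/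
lemma IsSelfAffine.abs_sub_linear_le {ε : ℝ} {W : ℝ → ℝ} (hW : IsSelfAffine ε tentProfile W)
    (h0 : 0 ≤ ε) (h1 : ε ≤ 1 / 2) {C : ℝ} (hC : ∀ x, |W x| ≤ C) (n : ℕ) (j : ℤ) (k K : ℕ)
    (hkK : k ≤ K) {D : ℝ} (hD : ∀ i, j ≤ i → i ≤ j + k → density ε n i ≤ D) (y : ℝ) (hy0 : 0 ≤ y)
    (hy1 : y ≤ 1) :
    |4 ^ n * (W ((j + k + y) / 4 ^ n) - W (j / 4 ^ n)) - slope4 ε tentProfile n j * (k + y)| ≤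
      4 * K * D * (k + y) + C * D := by
  have hP := isProfile_tentProfile
  have hε1 : ε < 1 := by linarith
  have hD0 : 0 ≤ D := (density_pos h0 hε1 n j).le.trans (hD j le_rfl (by omega))
  have hC0 : 0 ≤ C := (abs_nonneg _).trans (hC 0)
  have hgrid : ∀ m : ℕ, m ≤ k →
      |4 ^ n * (W ((j + m) / 4 ^ n) - W (j / 4 ^ n)) - slope4 ε tentProfile n j * m| ≤
        4 * K * D * m := by
    intro m hm
    induction m with
    | zero => simp
    | succ m ih =>
      have a1 := abs_le.1 (ih (by omega))
      have a2 := hW.grid hP h0 hε1 n (j + m) 1 zero_le_one le_rfl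
      have hz : W 1 = 0 := by simpa using hW.at_int hP h0 hε1 1
      rw [hz] at a2
      have a3 := slope4_add_sub_le h0 h1 n j m fun i hi hi' => hD i hi (by omega)
      have a4 : 4 * m * D ≤ 4 * K * D := by
        have : (m : ℝ) ≤ K := by exact_mod_cast (by omega : m ≤ K)
        gcongr
      have a5 := abs_le.1 (a3.trans a4)
      push_cast at a2 ⊢
      rw [← add_assoc, a2, abs_le]
      have e : 4 ^ n * (W ((j + m) / 4 ^ n) + (slope4 ε tentProfile n (j + m) * 1 +
          density ε n (j + m) * 0) / 4 ^ n - W (j / 4 ^ n)) =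
          4 ^ n * (W ((j + m) / 4 ^ n) - W (j / 4 ^ n)) + slope4 ε tentProfile n (j + m) := by
        field_simp
        ring
      rw [e]
      constructor <;> linarith
  have a1 := hgrid k le_rfl
  have a2 := hW.grid hP h0 hε1 n (j + k) y hy0 hy1
  have a3 := slope4_add_sub_le h0 h1 n j k fun i hi hi' => hD i hi (by omega)
  have a4 : 4 * k * D ≤ 4 * K * D := by
    have : (k : ℝ) ≤ K := by exact_mod_cast hkK
    gcongr
  push_cast at a2
  have e : 4 ^ n * (W ((j + k + y) / 4 ^ n) - W (j / 4 ^ n)) -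
      slope4 ε tentProfile n j * (k + y) =
      (4 ^ n * (W ((j + k) / 4 ^ n) - W (j / 4 ^ n)) - slope4 ε tentProfile n j * k) +
        (slope4 ε tentProfile n (j + k) - slope4 ε tentProfile n j) * y +
          density ε n (j + k) * W y := by
    rw [a2]
    field_simp
    ring
  have b1 : |(slope4 ε tentProfile n (j + k) - slope4 ε tentProfile n j) * y| ≤ 4 * K * D * y := by
    rw [abs_mul, abs_of_nonneg hy0]
    exact mul_le_mul_of_nonneg_right (a3.trans a4) hy0
  have b2 : |density ε n (j + k) * W y| ≤ C * D := by
    rw [abs_mul, abs_of_pos (density_pos h0 hε1 _ _), mul_comm]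
    exact mul_le_mul (hC y) (hD _ (by omega) le_rfl) (density_pos h0 hε1 _ _).le hC0
  rw [e]
  refine (abs_add_three _ _ _).trans ?_
  linarith

lemma IsSelfAffine.zygmund {ε : ℝ} {W F : ℝ → ℝ} (hW : IsSelfAffine ε tentProfile W)
    (hF : IsSelfSimilar ε F) (h0 : 0 ≤ ε) (h1 : ε ≤ 1 / 2) :
    ∃ M, 0 < M ∧ ∀ x h, 0 ≤ h →
      |W (x + h) - 2 * W x + W (x - h)| ≤ M * (F (x + h) - F (x - h)) := by
  obtain ⟨C, hC⟩ := hW.bdd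
  have hε1 : ε < 1 := by linarith
  have hC0 : 0 ≤ C := (abs_nonneg _).trans (hC 0)
  set κ := ((1 + ε) / (1 - ε)) ^ (16 * 3) with hκ
  have hκ1 : 1 ≤ κ := one_le_pow₀ (by rw [le_div_iff₀ (by linarith)]; linarith)
  -- `2400 = 4 * 24 * 25` is the linear approximation error over at most `25` cells; the factor `4`
  -- is the sum of the absolute weights `1, 2, 1` of the second difference, which kills the linear
  -- part.
  refine ⟨4 * (2400 + C) * κ, by positivity, fun x h hh => ?_⟩
  rcases hh.eq_or_lt with rfl | hh
  · simp only [add_zero, sub_zero, sub_self, mul_zero]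
    rw [show W x - 2 * W x + W x = 0 by ring, abs_zero]
  obtain ⟨n, hn, hn'⟩ := exists_scale 3 h hh
  obtain ⟨U, hU, hb⟩ := exists_density_bounds h0 hε1 3 n (x := x) hn'
  have hq : (0 : ℝ) < 4 ^ n := by positivity
  have l1 := hF.le_sub h0 hε1 n (by linarith : x - h ≤ x + h) hU.le
    fun i hi hi' => (hb i hi hi').1
  have l2 : U ≤ 4 ^ n * (F (x + h) - F (x - h)) := by
    refine le_trans ?_ l1
    push_cast at hn
    have : 1 ≤ 4 ^ n * (x + h - (x - h)) - 2 := by linarith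
    nlinarith
  refine le_of_mul_le_mul_left ?_ hq
  have l3 : 4 * (2400 + C) * κ * U ≤ 4 ^ n * (4 * (2400 + C) * κ * (F (x + h) - F (x - h))) := by
    have := mul_le_mul_of_nonneg_left l2 (by positivity : 0 ≤ 4 * (2400 + C) * κ)
    linarith
  refine le_trans ?_ l3
  rcases hn' with rfl | hn'
  -- At level `0` the density is `1`, and boundedness of `W` suffices.
  · have hU1 : 1 ≤ κ * U := by
      have := (hb _ le_rfl (Int.floor_le_floor (by gcongr; linarith))).2
      simpa [density] using this
    have c1 := abs_le.1 (hC (x + h))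
    have c2 := abs_le.1 (hC x)
    have c3 := abs_le.1 (hC (x - h))
    have : |W (x + h) - 2 * W x + W (x - h)| ≤ 4 * C := by
      rw [abs_le]; constructor <;> linarith
    rw [pow_zero, one_mul]
    nlinarith
  · set j := ⌊4 ^ n * (x - h)⌋ with hj
    set v := slope4 ε tentProfile n j
    have key : ∀ z, x - h ≤ z → z ≤ x + h →
        |4 ^ n * (W z - W (j / 4 ^ n)) - v * (4 ^ n * z - j)| ≤ (2400 + C) * κ * U := by
      intro z hz hz'
      have f1 : j ≤ ⌊4 ^ n * z⌋ := Int.floor_le_floor (by gcongr)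
      have f2 : ⌊4 ^ n * z⌋ ≤ ⌊4 ^ n * (x + h)⌋ := Int.floor_le_floor (by gcongr)
      have f3 : ⌊4 ^ n * (x + h)⌋ ≤ j + (24 : ℕ) := floor_sub_floor_le _ (by
        push_cast at hn' ⊢; linarith)
      obtain ⟨k, hk⟩ := Int.le.dest f1
      have hk24 : k ≤ 24 := by omega
      have hy0 := Int.fract_nonneg (4 ^ n * z)
      have hy1 := (Int.fract_lt_one (4 ^ n * z)).le
      have := hW.abs_sub_linear_le h0 h1 hC n j k 24 hk24 (D := κ * U)
        (fun i hi hi' => (hb i hi (by omega)).2) _ hy0 hy1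
      have hk' : (j : ℝ) + k = ⌊4 ^ n * z⌋ := by exact_mod_cast hk
      rw [hk', ← eq_floor_add_fract_div] at this
      have e : (k : ℝ) + Int.fract (4 ^ n * z) = 4 ^ n * z - j := by
        rw [← Int.self_sub_floor, ← hk']; ring
      have hle : (k : ℝ) + Int.fract (4 ^ n * z) ≤ 25 := by
        have : (k : ℝ) ≤ 24 := by exact_mod_cast hk24
        linarith
      rw [← e]
      refine this.trans ?_
      have hp : 0 ≤ κ * U := by positivity
      push_cast
      nlinarith
    have k1 := abs_le.1 (key (x + h) (by linarith) le_rfl)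
    have k2 := abs_le.1 (key x (by linarith) (by linarith))
    have k3 := abs_le.1 (key (x - h) le_rfl (by linarith))
    nth_rw 1 [← abs_of_pos hq]
    rw [← abs_mul, abs_le]
    constructor <;> linarith

/-! ### Linear growth of the variation on the grid -/

/-- A convex function of linear growth whose second derivative decays quadratically. -/
noncomputable def absSubLog (m : ℝ) : ℝ := |m| - Real.log (1 + |m|)

lemma absSubLog_nonneg (m : ℝ) : 0 ≤ absSubLog m := by
  have := Real.log_le_sub_one_of_pos (by positivity : 0 < 1 + |m|)
  unfold absSubLog
  linarith

lemma absSubLog_le (m : ℝ) : absSubLog m ≤ |m| := by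
  have := Real.log_nonneg (by linarith [abs_nonneg m] : 1 ≤ 1 + |m|)
  unfold absSubLog
  linarith

lemma absSubLog_neg (m : ℝ) : absSubLog (-m) = absSubLog m := by simp [absSubLog]

/-- For `y ≥ 0` this is an equality: the excess over the tangent depends only on the ratio `(1 + y)
/ (1 + m)`, which makes a bound uniform in `m` possible. -/
lemma absSubLog_tangent_gain {m : ℝ} (hm : 0 ≤ m) (y : ℝ) :
    absSubLog m + m / (1 + m) * (y - m) +
      ((1 + |y|) / (1 + m) - 1 - Real.log ((1 + |y|) / (1 + m))) ≤ absSubLog y := by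
  unfold absSubLog
  rw [abs_of_nonneg hm, Real.log_div (by positivity) (by positivity)]
  have h : m / (1 + m) * (y - m) ≤ m / (1 + m) * (|y| - m) :=
    mul_le_mul_of_nonneg_left (by linarith [le_abs_self y]) (by positivity)
  have e : m / (1 + m) * (|y| - m) + ((1 + |y|) / (1 + m) - 1) = |y| - m := by
    field_simp
    ring
  linarith

lemma absSubLog_tangent {m : ℝ} (hm : 0 ≤ m) (y : ℝ) :
    absSubLog m + m / (1 + m) * (y - m) ≤ absSubLog y := by
  have h := absSubLog_tangent_gain hm y
  have := Real.log_le_sub_one_of_pos (by positivity : 0 < (1 + |y|) / (1 + m))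
  linarith

lemma sub_log_mono {s t : ℝ} (hs : 1 ≤ s) (hst : s ≤ t) :
    s - 1 - Real.log s ≤ t - 1 - Real.log t := by
  have h := Real.log_le_sub_one_of_pos (div_pos (by linarith) (by linarith) : 0 < t / s)
  rw [Real.log_div (by linarith) (by linarith)] at h
  have h2 : t / s - 1 ≤ t - s := by
    rw [div_sub_one (by linarith), div_le_iff₀ (by linarith)]
    nlinarith
  linarith

/-- The gain of one subdivision step. -/
lemma absSubLog_step {ε : ℝ} (h0 : 0 < ε) (h1 : ε < 1) (m : ℝ) :
    4 * absSubLog m + (1 - ε) * (ε - Real.log (1 + ε)) ≤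
      2 * ((1 + ε) * absSubLog (m / (1 + ε))) + (1 - ε) * absSubLog ((m + 1) / (1 - ε)) +
        (1 - ε) * absSubLog ((m - 1) / (1 - ε)) := by
  wlog hm : 0 ≤ m generalizing m
  · have := this (-m) (by linarith)
    rw [absSubLog_neg, neg_div, absSubLog_neg, show -m + 1 = -(m - 1) by ring,
      show -m - 1 = -(m + 1) by ring, neg_div, neg_div, absSubLog_neg, absSubLog_neg] at this
    linarith
  have hε : 0 < 1 - ε := by linarith
  have t1 := absSubLog_tangent hm (m / (1 + ε))
  have t2 := absSubLog_tangent hm ((m - 1) / (1 - ε))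
  -- For `m ≥ 0` this child alone supplies the gain. Its ratio is `1 / (1 + m) + 1 / (1 - ε)`, at
  -- least `1 + ε` for every `m`. The linear terms of the tangents cancel in the sum.
  have t3 := absSubLog_tangent_gain hm ((m + 1) / (1 - ε))
  have hy : 0 ≤ (m + 1) / (1 - ε) := by positivity
  rw [abs_of_nonneg hy] at t3
  have hg : 1 + ε ≤ (1 + (m + 1) / (1 - ε)) / (1 + m) := by
    rw [le_div_iff₀ (by positivity), ← sub_le_iff_le_add', le_div_iff₀ hε]
    nlinarith [mul_nonneg hm h0.le, mul_nonneg h0.le h0.le, mul_nonneg hm (mul_nonneg h0.le h0.le)]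
  have hgain := sub_log_mono (by linarith) hg
  set d := m / (1 + m)
  have t1' := mul_le_mul_of_nonneg_left t1 (by linarith : 0 ≤ 1 + ε)
  have t2' := mul_le_mul_of_nonneg_left t2 hε.le
  have t3' := mul_le_mul_of_nonneg_left t3 hε.le
  have hgain' := mul_le_mul_of_nonneg_left hgain hε.le
  have e1 : (1 + ε) * (absSubLog m + d * (m / (1 + ε) - m)) =
      (1 + ε) * absSubLog m + d * (m - (1 + ε) * m) := by field_simp
  have e2 : (1 - ε) * (absSubLog m + d * ((m - 1) / (1 - ε) - m)) =
      (1 - ε) * absSubLog m + d * (m - 1 - (1 - ε) * m) := by field_simp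
  have e3 : ∀ r, (1 - ε) * (absSubLog m + d * ((m + 1) / (1 - ε) - m) + r) =
      (1 - ε) * absSubLog m + d * (m + 1 - (1 - ε) * m) + (1 - ε) * r := by
    intro r; field_simp
  rw [e1] at t1'
  rw [e2] at t2'
  rw [e3] at t3'
  linarith

/-- The potential whose growth forces the growth of the slopes. -/
noncomputable def slopePotential (ε : ℝ) (n : ℕ) (j : ℤ) : ℝ :=
  density ε n j * absSubLog (slope4 ε tentProfile n j / density ε n j)

lemma slopePotential_nonneg {ε : ℝ} (h0 : 0 ≤ ε) (h1 : ε < 1) (n : ℕ) (j : ℤ) :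
    0 ≤ slopePotential ε n j :=
  mul_nonneg (density_pos h0 h1 n j).le (absSubLog_nonneg _)

lemma slopePotential_le {ε : ℝ} (h0 : 0 ≤ ε) (h1 : ε < 1) (n : ℕ) (j : ℤ) :
    slopePotential ε n j ≤ |slope4 ε tentProfile n j| := by
  have hp := density_pos h0 h1 n j
  refine (mul_le_mul_of_nonneg_left (absSubLog_le _) hp.le).trans (le_of_eq ?_)
  rw [abs_div, abs_of_pos hp]
  field_simp

lemma slopePotential_children {ε : ℝ} (h0 : 0 < ε) (h1 : ε < 1) (n : ℕ) (j : ℤ) :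
    4 * slopePotential ε n j + (1 - ε) * (ε - Real.log (1 + ε)) * density ε n j ≤
      slopePotential ε (n + 1) (4 * j) + slopePotential ε (n + 1) (4 * j + 1) +
        slopePotential ε (n + 1) (4 * j + 2) + slopePotential ε (n + 1) (4 * j + 3) := by
  have hp := density_pos h0.le h1 n j
  have d0 : 4 * j / 4 = j := by omega
  have d1 : (4 * j + 1) / 4 = j := by omega
  have d2 : (4 * j + 2) / 4 = j := by omega
  have d3 : (4 * j + 3) / 4 = j := by omega
  have m0 : 4 * j % 4 = 0 := by omega
  have m1 : (4 * j + 1) % 4 = 1 := by omega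
  have m2 : (4 * j + 2) % 4 = 2 := by omega
  have m3 : (4 * j + 3) % 4 = 3 := by omega
  have m4 : (4 * j + 3 + 1) % 4 = 0 := by omega
  have m2' : (4 * j + 1 + 1) % 4 = 2 := by omega
  have m3' : (4 * j + 2 + 1) % 4 = 3 := by omega
  have hε : 1 - ε ≠ 0 := by linarith
  have hε' : 1 + ε ≠ 0 := by linarith
  have hstep := mul_le_mul_of_nonneg_left
    (absSubLog_step h0 h1 (slope4 ε tentProfile n j / density ε n j)) hp.le
  simp only [slopePotential, slope4, density, d0, d1, d2, d3, tentProfile, outerSign, m0, m1, m2,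
    m3, m4, m2', m3']
  norm_num
  set u := density ε n j
  set v := slope4 ε tentProfile n j
  have e1 : v / (u * (1 + ε)) = v / u / (1 + ε) := by field_simp
  have e2 : (v + u) / (u * (1 + -ε)) = (v / u + 1) / (1 - ε) := by
    rw [← sub_eq_add_neg]; field_simp
  have e3 : (v + -u) / (u * (1 + -ε)) = (v / u - 1) / (1 - ε) := by
    rw [← sub_eq_add_neg, ← sub_eq_add_neg]; field_simp
  rw [e1, e2, e3]
  linarith

lemma sum_range_four_mul {f : ℕ → ℝ} (m : ℕ) :
    ∑ k ∈ Finset.range (4 * m), f k =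
      ∑ k ∈ Finset.range m, (f (4 * k) + f (4 * k + 1) + f (4 * k + 2) + f (4 * k + 3)) := by
  induction m with
  | zero => simp
  | succ m ih =>
    rw [mul_add, mul_one, Finset.sum_range_succ _ m, ← ih]
    simp only [Finset.sum_range_succ]
    ring

lemma sum_density {ε : ℝ} (N n : ℕ) (p : ℤ) :
    ∑ k ∈ Finset.range (4 ^ n), density ε (N + n) (p * 4 ^ n + k) = 4 ^ n * density ε N p := by
  induction n with
  | zero => simp
  | succ n ih =>
    rw [pow_succ' 4 n, sum_range_four_mul, pow_succ' 4 n, pow_succ' 4 n, mul_assoc, ← ih,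
      Finset.mul_sum]
    refine Finset.sum_congr rfl fun k _ => ?_
    have d0 : ∀ r : ℤ, 0 ≤ r → r < 4 → (p * (4 * 4 ^ n) + (4 * k + r)) / 4 = p * 4 ^ n + k :=
      fun r _ _ => by
        rw [show p * (4 * 4 ^ n) + (4 * k + r) = r + (p * 4 ^ n + k) * 4 by ring]; omega
    have m0 : ∀ r : ℤ, 0 ≤ r → r < 4 → (p * (4 * 4 ^ n) + (4 * k + r)) % 4 = r :=
      fun r _ _ => by
        rw [show p * (4 * 4 ^ n) + (4 * k + r) = r + (p * 4 ^ n + k) * 4 by ring]; omega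
    have d00 := d0 0 (by norm_num) (by norm_num)
    have m00 := m0 0 (by norm_num) (by norm_num)
    rw [add_zero] at d00 m00
    push_cast
    simp only [density, outerSign, d00, d0 1, d0 2, d0 3, m00, m0 1, m0 2, m0 3, Int.reduceLE,
      Int.reduceLT]
    norm_num
    ring

/-- Each refinement adds a multiple of the total density, which `sum_density` shows to be conserved
after normalization by the number of cells. -/
lemma le_sum_slopePotential {ε : ℝ} (h0 : 0 < ε) (h1 : ε < 1) (N n : ℕ) (p : ℤ) :
    4 ^ n * (n * ((1 - ε) * (ε - Real.log (1 + ε)) / 4) * density ε N p) ≤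
      ∑ k ∈ Finset.range (4 ^ n), slopePotential ε (N + n) (p * 4 ^ n + k) := by
  induction n with
  | zero => simpa using slopePotential_nonneg h0.le h1 N p
  | succ n ih =>
    rw [pow_succ' 4 n, pow_succ' 4 n, pow_succ' 4 n, sum_range_four_mul]
    set c := (1 - ε) * (ε - Real.log (1 + ε)) with hc
    calc _ = 4 * (4 ^ n * (n * (c / 4) * density ε N p)) + c * (4 ^ n * density ε N p) := by
          push_cast; ring
      _ ≤ 4 * ∑ k ∈ Finset.range (4 ^ n), slopePotential ε (N + n) (p * 4 ^ n + k) +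
          c * ∑ k ∈ Finset.range (4 ^ n), density ε (N + n) (p * 4 ^ n + k) := by
        rw [sum_density]
        linarith
      _ = ∑ k ∈ Finset.range (4 ^ n), (4 * slopePotential ε (N + n) (p * 4 ^ n + k) +
          c * density ε (N + n) (p * 4 ^ n + k)) := by
        rw [Finset.sum_add_distrib, Finset.mul_sum, Finset.mul_sum]
      _ ≤ _ := by
        refine Finset.sum_le_sum fun k _ => ?_
        refine (slopePotential_children h0 h1 (N + n) (p * 4 ^ n + k)).trans (le_of_eq ?_)
        have e : p * (4 * 4 ^ n) + 4 * (k : ℤ) = 4 * (p * 4 ^ n + k) := by ring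
        push_cast
        simp only [← add_assoc, e]

/-- The total variation on the grid of level `N + n` grows linearly in `n`. -/
lemma le_sum_abs_slope {ε : ℝ} (h0 : 0 < ε) (h1 : ε < 1) (N : ℕ) (p : ℤ) :
    ∃ c, 0 < c ∧ ∀ n : ℕ, c * n ≤ ∑ k ∈ Finset.range (4 ^ n),
      |slope4 ε tentProfile (N + n) (p * 4 ^ n + k)| / 4 ^ (N + n) := by
  have hlog : Real.log (1 + ε) < ε := by
    have := Real.log_lt_sub_one_of_pos (by linarith : 0 < 1 + ε) (by linarith)
    linarith
  have hp := density_pos h0.le h1 N p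
  refine ⟨(1 - ε) * (ε - Real.log (1 + ε)) / 4 * density ε N p / 4 ^ N, ?_, fun n => ?_⟩
  · have : 0 < 1 - ε := by linarith
    have : 0 < ε - Real.log (1 + ε) := by linarith
    positivity
  · rw [← Finset.sum_div, le_div_iff₀ (by positivity)]
    refine le_trans (le_of_eq ?_) ((le_sum_slopePotential h0 h1 N n p).trans
      (Finset.sum_le_sum fun k _ => slopePotential_le h0.le h1 _ _))
    rw [pow_add]
    field_simp

/-! ### Infinite `Φ`-variation -/

/-- Above `8 ^ (-m)` the logarithm is at most `m * log 8`; below it the left side is nonpositive.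
The subtraction avoids splitting the sum into large and small increments. -/
lemma IsLogGauge.lower_bound {q : ℝ} {Φ : ℝ → ℝ} (hΦ : IsLogGauge q Φ) (hq : 0 < q) :
    ∃ e : ℝ, 0 < e ∧ ∀ (t : ℝ) (m : ℕ), 0 ≤ t → t < e → 1 ≤ m →
      (t - (1 / 8) ^ m) / (m * Real.log 8) ^ q ≤ Φ t := by
  obtain ⟨e, he, hΦe⟩ := hΦ.eq_small
  refine ⟨min e 1, lt_min he one_pos, fun t m ht hte hm => ?_⟩
  have hm' : (0 : ℝ) < m := by exact_mod_cast hm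
  have hl8 : 0 < Real.log 8 := Real.log_pos (by norm_num)
  have hA : 0 < (m * Real.log 8) ^ q := Real.rpow_pos_of_pos (by positivity) q
  have h8 : (0 : ℝ) < (1 / 8) ^ m := by positivity
  rcases le_total t ((1 / 8) ^ m) with h | h
  · exact (div_nonpos_of_nonpos_of_nonneg (by linarith) hA.le).trans (hΦ.nonneg t ht)
  · have ht0 : 0 < t := h8.trans_le h
    rw [hΦe t ht0 (hte.trans_le (min_le_left _ _))]
    have ht1 : t < 1 := hte.trans_le (min_le_right _ _)
    have hlog : 0 < Real.log (1 / t) := Real.log_pos (by rw [lt_div_iff₀ ht0]; linarith)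
    have hlog2 : Real.log (1 / t) ≤ m * Real.log 8 := by
      rw [← Real.log_pow]
      refine Real.log_le_log (by positivity) ?_
      rw [div_le_iff₀ ht0]
      have : (8 : ℝ) ^ m * (1 / 8) ^ m = 1 := by rw [← mul_pow]; norm_num
      have := mul_le_mul_of_nonneg_left h (by positivity : (0 : ℝ) ≤ 8 ^ m)
      linarith
    have hr := Real.rpow_le_rpow hlog.le hlog2 hq.le
    have hr0 : 0 < Real.log (1 / t) ^ q := Real.rpow_pos_of_pos hlog q
    exact div_le_div₀ ht0.le (by linarith) hr0 hr

/-- Extending a uniform partition of a subinterval to a partition of `[a, b]`. -/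
lemma exists_mem_phiVariationSums {Φ : ℝ → ℝ} (hΦ : ∀ t, 0 ≤ t → 0 ≤ Φ t) (v : ℝ → ℝ) {a b : ℝ}
    (K : ℕ) (y : ℕ → ℝ) (hy : ∀ j < K, y j < y (j + 1)) (ha : a < y 0) (hb : y K < b) :
    ∃ S ∈ phiVariationSums Φ v a b, ∑ k ∈ Finset.range K, Φ |v (y (k + 1)) - v (y k)| ≤ S := by
  -- The points `y` are shifted by one index to make room for `a`; the two extra increments only add
  -- nonnegative terms.
  let x : ℕ → ℝ := fun k => if k = 0 then a else if k ≤ K + 1 then y (k - 1) else b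
  have hx : ∀ k ≤ K, x (k + 1) = y k := fun k hk => by simp [x, hk]
  have hx0 : x 0 = a := by simp [x]
  have hxK : x (K + 2) = b := by simp [x]
  refine ⟨_, ⟨K + 2, x, by omega, hx0, hxK, fun j hj => ?_, rfl⟩, ?_⟩
  · rcases Nat.eq_zero_or_pos j with rfl | hj0
    · rwa [hx0, hx 0 (Nat.zero_le _)]
    · obtain ⟨i, rfl⟩ : ∃ i, j = i + 1 := ⟨j - 1, by omega⟩
      rcases (by omega : i = K ∨ i < K) with rfl | hi
      · rwa [hx i le_rfl, hxK]
      · rw [hx i hi.le, hx (i + 1) hi]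
        exact hy i hi
  · rw [Finset.sum_range_succ, Finset.sum_range_succ']
    have e : ∑ k ∈ Finset.range K, Φ |v (x (k + 1 + 1)) - v (x (k + 1))| =
        ∑ k ∈ Finset.range K, Φ |v (y (k + 1)) - v (y k)| := by
      refine Finset.sum_congr rfl fun k hk => ?_
      have hk' := Finset.mem_range.1 hk
      rw [hx k hk'.le, hx (k + 1) hk']
    rw [e]
    have h1 := hΦ _ (abs_nonneg (v (x (0 + 1)) - v (x 0)))
    have h2 := hΦ _ (abs_nonneg (v (x (K + 1 + 1)) - v (x (K + 1))))
    linarith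

lemma exists_grid_interval {a b : ℝ} (hab : a < b) :
    ∃ (N : ℕ) (p : ℤ), a < p / 4 ^ N ∧ ((p : ℝ) + 1) / 4 ^ N < b := by
  obtain ⟨N, hN⟩ := pow_unbounded_of_one_lt (3 / (b - a)) (by norm_num : (1 : ℝ) < 4)
  rw [div_lt_iff₀ (by linarith)] at hN
  refine ⟨N, ⌊4 ^ N * a⌋ + 1, ?_, ?_⟩
  · rw [lt_div_iff₀ (by positivity), mul_comm]
    push_cast
    exact Int.lt_floor_add_one _
  · rw [div_lt_iff₀ (by positivity)]
    push_cast
    linarith [Int.floor_le (4 ^ N * a)]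

lemma tendsto_linear_div_rpow {c L q : ℝ} (hc : 0 < c) (hL : 0 < L) (hq : q < 1) (N : ℕ) :
    Tendsto (fun n : ℕ => (c * n - 1) / (((N + n : ℕ) : ℝ) * L) ^ q) atTop atTop := by
  have hm : Tendsto (fun n : ℕ => ((N + n : ℕ) : ℝ)) atTop atTop :=
    tendsto_natCast_atTop_atTop.comp (tendsto_atTop_mono (fun n => Nat.le_add_left n N) tendsto_id)
  have h1 : Tendsto (fun n : ℕ => ((N + n : ℕ) : ℝ) ^ (1 - q)) atTop atTop :=
    (tendsto_rpow_atTop (by linarith)).comp hm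
  have h2 : Tendsto (fun n : ℕ => c - (c * N + 1) / ((N + n : ℕ) : ℝ)) atTop (𝓝 c) := by
    simpa using (tendsto_const_nhds.div_atTop hm).const_sub c
  have h3 := (h1.atTop_mul_pos hc h2).const_mul_atTop
    (inv_pos.2 (Real.rpow_pos_of_pos hL q))
  refine h3.congr' ?_
  filter_upwards [eventually_ge_atTop 1] with n hn
  have hpos : (0 : ℝ) < ((N + n : ℕ) : ℝ) := by exact_mod_cast (by omega : 0 < N + n)
  rw [Real.mul_rpow hpos.le hL.le, Real.rpow_sub hpos, Real.rpow_one]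
  have := Real.rpow_pos_of_pos hpos q
  have := Real.rpow_pos_of_pos hL q
  field_simp
  push_cast
  ring

lemma IsSelfAffine.not_hasFinitePhiVariation {ε : ℝ} {W : ℝ → ℝ}
    (hW : IsSelfAffine ε tentProfile W) (h0 : 0 < ε) (h1 : ε < 1) {q : ℝ} (hq0 : 0 < q)
    (hq1 : q < 1) {Φ : ℝ → ℝ} (hΦ : IsLogGauge q Φ) {a b : ℝ} (hab : a < b) :
    ¬ HasFinitePhiVariation Φ W a b := by
  have hP := isProfile_tentProfile
  rintro ⟨B, hB⟩
  obtain ⟨N, p, ha, hb⟩ := exists_grid_interval hab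
  obtain ⟨c, hc, hsum⟩ := le_sum_abs_slope h0 h1 N p
  obtain ⟨e, he, hΦe⟩ := hΦ.lower_bound hq0
  have hL : 0 < Real.log 8 := Real.log_pos (by norm_num)
  have ht : Tendsto (fun n : ℕ => (1 / 2 : ℝ) ^ n) atTop (𝓝 0) :=
    tendsto_pow_atTop_nhds_zero_of_lt_one (by norm_num) (by norm_num)
  -- The level must make the lower bound exceed `B`, put all increments in the range of the explicit
  -- formula for `Φ`, and be positive.
  obtain ⟨n, ⟨hn1, hn2⟩, hn3⟩ := (((tendsto_linear_div_rpow hc hL hq1 N).eventually_gt_atTop B).and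
    (ht.eventually_lt_const he) |>.and (eventually_ge_atTop 1)).exists
  set m := N + n with hm
  set d : ℕ → ℝ := fun k => |slope4 ε tentProfile m (p * 4 ^ n + k)| / 4 ^ m with hd
  let y : ℕ → ℝ := fun k => ((p * 4 ^ n + k : ℤ) : ℝ) / 4 ^ m
  have hz : W 1 = 0 := by simpa using hW.at_int hP h0.le h1 1
  have hinc : ∀ k, |W (y (k + 1)) - W (y k)| = d k := fun k => by
    have := hW.grid hP h0.le h1 m (p * 4 ^ n + k) 1 zero_le_one le_rfl
    rw [hz, mul_zero, add_zero, mul_one] at this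
    have e : y (k + 1) = (((p * 4 ^ n + k : ℤ) : ℝ) + 1) / 4 ^ m := by
      simp only [y]; push_cast; ring
    rw [e, this, add_sub_cancel_left, abs_div, abs_of_pos (by positivity : (0 : ℝ) < 4 ^ m)]
  have hdlt : ∀ k, d k < e := fun k => by
    refine lt_of_le_of_lt ?_ hn2
    have h2 : (1 / 2 : ℝ) ^ m ≤ (1 / 2) ^ n :=
      pow_le_pow_of_le_one (by norm_num) (by norm_num) (by omega)
    refine le_trans ?_ h2
    rw [hd, div_le_iff₀ (by positivity), ← mul_pow]
    norm_num
    exact hP.abs_slope_le h0.le h1 m _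
  obtain ⟨S, hS, hle⟩ := exists_mem_phiVariationSums hΦ.nonneg W (a := a) (b := b) (4 ^ n) y
    (fun j _ => by
      simp only [y]
      gcongr
      omega)
    (by
      refine ha.trans_le (le_of_eq ?_)
      simp only [y, hm, pow_add]
      push_cast
      field_simp
      ring)
    (by
      refine lt_of_le_of_lt (le_of_eq ?_) hb
      simp only [y, hm, pow_add]
      push_cast
      field_simp)
  have hSB := hB hS
  simp only [hinc] at hle
  have hA : 0 < ((m : ℝ) * Real.log 8) ^ q :=
    Real.rpow_pos_of_pos (mul_pos (by exact_mod_cast (by omega : 0 < m)) hL) q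
  have h3 : ∑ k ∈ Finset.range (4 ^ n), (d k - (1 / 8) ^ m) / (m * Real.log 8) ^ q ≤
      ∑ k ∈ Finset.range (4 ^ n), Φ (d k) :=
    Finset.sum_le_sum fun k _ => hΦe (d k) m (by positivity) (hdlt k) (by omega)
  rw [← Finset.sum_div, Finset.sum_sub_distrib, Finset.sum_const, Finset.card_range,
    nsmul_eq_mul] at h3
  -- The total loss over all cells stays bounded because the cutoff base `8` exceeds the branching
  -- number `4`.
  have h4 : ((4 ^ n : ℕ) : ℝ) * (1 / 8) ^ m ≤ 1 := by
    push_cast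
    calc (4 : ℝ) ^ n * (1 / 8) ^ m ≤ 4 ^ n * (1 / 8) ^ n := by
          refine mul_le_mul_of_nonneg_left ?_ (by positivity)
          exact pow_le_pow_of_le_one (by norm_num) (by norm_num) (by omega)
      _ = (1 / 2) ^ n := by rw [← mul_pow]; norm_num
      _ ≤ 1 := pow_le_one₀ (by norm_num) (by norm_num)
  have h5 : (c * n - 1) / (m * Real.log 8) ^ q ≤
      (∑ k ∈ Finset.range (4 ^ n), d k - ((4 ^ n : ℕ) : ℝ) * (1 / 8) ^ m) /
        (m * Real.log 8) ^ q := by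
    gcongr
    exact hsum n
  linarith

theorem mainTheorem4 (δ : ℝ) (hδ : 0 < δ) :
    ∃ μ : Measure ℝ, μ.Regular ∧ (∀ x : ℝ, μ {x} = 0) ∧ IsDoublingWith μ δ ∧
      ∃ g ∈ ZygmundClass μ, ∀ q : ℝ, 0 < q → q < 1 → ∀ Φ : ℝ → ℝ, IsLogGauge q Φ →
        ∀ a b : ℝ, a < b → ¬ HasFinitePhiVariation Φ g a b := by
  obtain ⟨N, ε, hNδ, h0, h1, hε⟩ := exists_doubling_parameters hδ
  have hε1 : ε < 1 := by linarith
  obtain ⟨F, hF⟩ := exists_isSelfSimilar h0.le hε1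
  obtain ⟨W, hW⟩ := isProfile_tentProfile.exists_selfAffine h0.le hε1.le
  let f : StieltjesFunction ℝ := ⟨F, hF.mono h0.le hε1, fun x => hF.cont.continuousWithinAt⟩
  have hlim : ∀ x, Function.leftLim f x = F x := fun x =>
    hF.cont.continuousWithinAt.leftLim_eq
  have hIcc : ∀ a b, f.measure (Icc a b) = ENNReal.ofReal (F b - F a) := fun a b => by
    rw [f.measure_Icc, hlim]
  refine ⟨f.measure, inferInstance, fun x => ?_, ⟨fun h => ?_, fun x h hh => ?_⟩, W,
    ⟨hW.continuous isProfile_tentProfile h0.le hε1, ?_⟩, ?_⟩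
  · rw [← Icc_self, hIcc, sub_self, ENNReal.ofReal_zero]
  · have h2 := hIcc 0 1
    have h3 := hF.grid_succ 0 0
    simp only [pow_zero, Int.cast_zero, zero_add, div_one, one_mul, density] at h3
    rw [h, h3] at h2
    simp at h2
  · obtain ⟨ha, hb⟩ := hF.doubling h0.le hε1 N hδ hNδ hε x h hh
    rw [hIcc, hIcc, ← ENNReal.ofReal_mul (by linarith), ← ENNReal.ofReal_mul (by linarith)]
    exact ⟨ENNReal.ofReal_le_ofReal ha, ENNReal.ofReal_le_ofReal hb⟩
  · obtain ⟨M, hM, hz⟩ := hW.zygmund hF h0.le h1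
    refine ⟨M, hM, fun x h hh => ?_⟩
    rw [hIcc, ← ENNReal.ofReal_mul hM.le]
    exact ENNReal.ofReal_le_ofReal (hz x h hh)
  · intro q hq0 hq1 Φ hΦ a b hab
    exact hW.not_hasFinitePhiVariation h0 hε1 hq0 hq1 hΦ hab
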